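/- Let $n \ge 0$ and let $f : \{0,1\}^n \to \{0,1\}$ be a Boolean function. A deterministic OBDD of width $m$ consists of a permutation $\pi$ of $\{1,\dots,n\}$, a set $S$ of $m$ states, an initial state, a set $S_a \subseteq S$ of accepting states, and transition functions $\delta_i^0, \delta_i^1 : S \to S$ for $1 \le i \le n$. On input $x$ it applies $\delta_1^{x_{\pi(1)}}, \dots, \delta_n^{x_{\pi(n)}}$ in turn, starting from the initial state. It computes $f$ if the final state lies in $S_a$ exactly when $f(x) = 1$. A probabilistic OBDD (POBDD) of width $m$ is defined in the same way, except that the initial state is a probability vector $v_0 \in \mathbb{R}^S$ and step $i$ is $v_i = T_i^{x_{\pi(i)}} v_{i-1}$ with column-stochastic matrices $T_i^0, T_i^1$. It accepts $x$ with probability $\sum_{s \in S_a} v_n[s]$. It computes $f$ with zero error if it accepts every $x$ with $f(x)=1$ with probability $1$ and every $x$ with $f(x)=0$ with probability $0$. In a Las Vegas POBDD, $S$ is split into three disjoint sets of accepting, rejecting and neutral ("don't know") states. It computes $f$ with error bound $\varepsilon$ if every $x$ with $f(x)=1$ is rejected with probability $0$ and accepted with probability at least $1-\varepsilon$, and every $x$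 with $f(x)=0$ is accepted with probability $0$ and rejected with probability at least $1-\varepsilon$. Let $\mathsf{OBDD}(f)$, $\mathsf{exact\text{-}POBDD}(f)$ and $\mathsf{LV\text{-}OBDD}_\varepsilon(f)$ denote the minimum widths, over all variable orders $\pi$, of a deterministic OBDD computing $f$, of a POBDD computing $f$ with zero error, and of a Las Vegas POBDD computing $f$ with error bound $\varepsilon$, respectively. **Theorem.** For every real $\varepsilon$ with $0 \le \varepsilon < 1$, $$\mathsf{OBDD}(f)^{1-\varepsilon} \le \mathsf{LV\text{-}OBDD}_\varepsilon(f).$$ Moreover $\mathsf{OBDD}(f) = \mathsf{exact\text{-}POBDD}(f)$; in particular, zero-error POBDDs are no narrower than deterministic OBDDs. -/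

import Mathlib

/-- A deterministic OBDD of width `m` over the variables `x 0, …, x (n - 1)`. Step `i` reads the
variable `x (order i)` and applies the transition function of level `i`. -/
structure DetOBDD (n m : ℕ) where
  order : Equiv.Perm (Fin n)
  init : Fin m
  step : Fin n → Bool → Fin m → Fin m
  accept : Finset (Fin m)

/-- A probabilistic OBDD (POBDD) of width `m`: the initial state is a stochastic vector, and
step `i` applies the left (that is, column) stochastic matrix `trans i b`, where `b` is the value
of the variable `x (order i)`. -/
structure POBDD (n m : ℕ) where
  order : Equiv.Perm (Fin n)
  init : Fin m → ℝ
  init_mem : init ∈ stdSimplex ℝ (Fin m)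
  trans : Fin n → Bool → Matrix (Fin m) (Fin m) ℝ
  trans_mem : ∀ i b, trans i b ∈ Matrix.colStochastic ℝ (Fin m)
  accept : Finset (Fin m)

/-- A Las Vegas POBDD: the states are split into accepting, rejecting and neutral states. The
neutral ("don't know") states are those that are neither accepting nor rejecting. -/
structure LVPOBDD (n m : ℕ) extends POBDD n m where
  reject : Finset (Fin m)
  disjoint_accept_reject : Disjoint accept reject

namespace DetOBDD

variable {n m : ℕ}

/-- The state after the first `j` steps on the input `x`. -/
def stateAt (P : DetOBDD n m) (x : Fin n → Bool) (j : Fin (n + 1)) : Fin m :=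
  Fin.induction (motive := fun _ => Fin m) P.init (fun i s => P.step i (x (P.order i)) s) j

/-- The OBDD computes `f`: it accepts exactly the inputs in `f ⁻¹ {1}`. -/
def Computes (P : DetOBDD n m) (f : (Fin n → Bool) → Bool) : Prop :=
  ∀ x, P.stateAt x (Fin.last n) ∈ P.accept ↔ f x = true

end DetOBDD

namespace POBDD

variable {n m : ℕ}

/-- The probability vector after the first `j` steps on the input `x`. -/
def vecAt (P : POBDD n m) (x : Fin n → Bool) (j : Fin (n + 1)) : Fin m → ℝ :=
  Fin.induction (motive := fun _ => Fin m → ℝ) P.init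
    (fun i v => (P.trans i (x (P.order i))).mulVec v) j

/-- The probability that the final state lies in `A`. -/
def prob (P : POBDD n m) (x : Fin n → Bool) (A : Finset (Fin m)) : ℝ :=
  ∑ s ∈ A, P.vecAt x (Fin.last n) s

/-- Zero-error (exact) computation: members are accepted with probability one, non-members with
probability zero. -/
def ComputesExactly (P : POBDD n m) (f : (Fin n → Bool) → Bool) : Prop :=
  ∀ x, P.prob x P.accept = if f x = true then 1 else 0

end POBDD

/-- Las Vegas computation of `f` with error bound `ε`: the wrong decision is made with probability
zero, and the right decision is made with probability at least `1 - ε`. -/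
def LVPOBDD.Computes {n m : ℕ} (P : LVPOBDD n m) (ε : ℝ) (f : (Fin n → Bool) → Bool) : Prop :=
  ∀ x,
    (f x = true → P.prob x P.reject = 0 ∧ 1 - ε ≤ P.prob x P.accept) ∧
    (f x = false → P.prob x P.accept = 0 ∧ 1 - ε ≤ P.prob x P.reject)

/-- `OBDD(f)`: the minimum width of a deterministic OBDD (with any variable order) computing `f`. -/
noncomputable def obddWidth {n : ℕ} (f : (Fin n → Bool) → Bool) : ℕ :=
  sInf {m | ∃ P : DetOBDD n m, P.Computes f}

/-- `exact-POBDD(f)`: the minimum width of a POBDD computing `f` with zero error. -/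
noncomputable def exactPOBDDWidth {n : ℕ} (f : (Fin n → Bool) → Bool) : ℕ :=
  sInf {m | ∃ P : POBDD n m, P.ComputesExactly f}

/-- `LV-OBDD_ε(f)`: the minimum width of a Las Vegas POBDD computing `f` with error bound `ε`. -/
noncomputable def lvOBDDWidth {n : ℕ} (ε : ℝ) (f : (Fin n → Bool) → Bool) : ℕ :=
  sInf {m | ∃ P : LVPOBDD n m, P.Computes ε f}

/-! The three minima range over non-empty sets, so none of them is a default value. -/

theorem exists_detOBDD {n : ℕ} (f : (Fin n → Bool) → Bool) :
    {m | ∃ P : DetOBDD n m, P.Computes f}.Nonempty := by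
  classical
  let e := Fintype.equivFin (Fin n → Bool)
  let P : DetOBDD n (Fintype.card (Fin n → Bool)) :=
    { order := Equiv.refl _
      init := e fun _ => false
      step := fun i b s => e (Function.update (e.symm s) i b)
      accept := Finset.univ.filter fun s => f (e.symm s) = true }
  refine ⟨_, P, fun x => ?_⟩
  have key : ∀ j : Fin (n + 1), P.stateAt x j =
      e fun k => if k.castSucc < j then x k else false := by
    intro j
    induction j using Fin.induction with
    | zero => simp [DetOBDD.stateAt, P]
    | succ i ih =>
      have h : P.stateAt x i.succ = P.step i (x (P.order i)) (P.stateAt x i.castSucc) := by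
        simp [DetOBDD.stateAt]
      rw [h, ih]
      simp only [P, Equiv.symm_apply_apply, Equiv.refl_apply]
      congr 1
      funext k
      by_cases hk : k = i
      · subst hk; simp
      · have : k < i ↔ k ≤ i := ⟨le_of_lt, fun h => lt_of_le_of_ne h hk⟩
        simp [Function.update_of_ne hk, this, Fin.castSucc_lt_succ_iff]
  have hl := key (Fin.last n)
  simp only [Fin.castSucc_lt_last, if_true] at hl
  rw [hl]
  simp [P]

/-- A deterministic OBDD is a POBDD whose stochastic elements consist of zeros and ones. -/
def DetOBDD.toPOBDD {n m : ℕ} (P : DetOBDD n m) : POBDD n m where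
  order := P.order
  init := Pi.single P.init 1
  init_mem := single_mem_stdSimplex ℝ P.init
  trans := fun i b => Matrix.of fun t s => if t = P.step i b s then 1 else 0
  trans_mem := fun i b => by
    rw [Matrix.mem_colStochastic_iff_sum]
    refine ⟨fun t s => ?_, fun s => ?_⟩
    · simp only [Matrix.of_apply]; split_ifs <;> norm_num
    · simp
  accept := P.accept

theorem DetOBDD.vecAt_toPOBDD {n m : ℕ} (P : DetOBDD n m) (x : Fin n → Bool) (j : Fin (n + 1)) :
    P.toPOBDD.vecAt x j = Pi.single (P.stateAt x j) 1 := by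
  induction j using Fin.induction with
  | zero => simp [POBDD.vecAt, DetOBDD.stateAt, DetOBDD.toPOBDD]
  | succ i ih =>
    have h : P.toPOBDD.vecAt x i.succ =
        (P.toPOBDD.trans i (x (P.order i))).mulVec (P.toPOBDD.vecAt x i.castSucc) := by
      simp [POBDD.vecAt, DetOBDD.toPOBDD]
    have h' : P.stateAt x i.succ = P.step i (x (P.order i)) (P.stateAt x i.castSucc) := by
      simp [DetOBDD.stateAt]
    rw [h, ih, h']
    funext t
    simp [DetOBDD.toPOBDD, Pi.single_apply]

theorem DetOBDD.prob_toPOBDD {n m : ℕ} (P : DetOBDD n m) (x : Fin n → Bool)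
    (A : Finset (Fin m)) :
    P.toPOBDD.prob x A = if P.stateAt x (Fin.last n) ∈ A then 1 else 0 := by
  simp [POBDD.prob, DetOBDD.vecAt_toPOBDD, Pi.single_apply]

theorem exists_exactPOBDD {n : ℕ} (f : (Fin n → Bool) → Bool) :
    {m | ∃ P : POBDD n m, P.ComputesExactly f}.Nonempty := by
  obtain ⟨m, P, hP⟩ := exists_detOBDD f
  refine ⟨m, P.toPOBDD, fun x => ?_⟩
  have h : P.stateAt x (Fin.last n) ∈ P.toPOBDD.accept ↔ f x = true := hP x
  simp only [DetOBDD.prob_toPOBDD, h]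

theorem exists_lvOBDD {n : ℕ} {ε : ℝ} (hε : 0 ≤ ε) (f : (Fin n → Bool) → Bool) :
    {m | ∃ P : LVPOBDD n m, P.Computes ε f}.Nonempty := by
  obtain ⟨m, P, hP⟩ := exists_detOBDD f
  let Q : LVPOBDD n m :=
    { P.toPOBDD with
      reject := P.acceptᶜ
      disjoint_accept_reject := disjoint_compl_right }
  refine ⟨m, Q, fun x => ?_⟩
  have ha : Q.prob x Q.accept = if P.stateAt x (Fin.last n) ∈ P.accept then 1 else 0 :=
    P.prob_toPOBDD x P.accept
  have hr : Q.prob x Q.reject = if P.stateAt x (Fin.last n) ∈ P.acceptᶜ then 1 else 0 :=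
    P.prob_toPOBDD x P.acceptᶜ
  have h := hP x
  rw [ha, hr]
  constructor
  · intro hf
    simp [h, hf, hε]
  · intro hf
    simp [h, hf, hε]

/-!
For a variable order `π` and a level `j`, the first `j` variables of an input `x` leave a
subfunction of `f` in the remaining variables. A deterministic OBDD with order `π` can store
exactly this subfunction, so `obddWidth f` is at most the largest number of subfunctions over the
levels of `π` (`obddWidth_le_of_card_subfunction_le`). It remains to show that a Las Vegas POBDD
with order `π`, width `m` and error bound `ε` satisfies `N ^ (1 - ε) ≤ m`, where `N` is the number
of subfunctions at any one level.

Fix a level. After its steps, each of the `N` subfunctions `i`, through a prefix representing it,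
gives a probability vector `v i` on the states, and from a state `s`, each assignment `y` of the
later variables gives the answer `b` with probability `c s y b`. From `s` one can guess `i`: split
the set of candidates by an assignment `y` on which two of them differ, run the program from `s` on
`y`, follow the answer if there is one, and otherwise follow the value `b` with probability
proportional to the number of candidates `k` with `k y = b`; then repeat within the part. The right
candidate `i` never loses against a wrong answer, and each split costs it, in the geometric mean
over `s` weighted by `v i`, at most the factor `p ^ ε`, where `p` is the relative size of its part.
These factors multiply to `N ^ (-ε)` (`exists_guess`). Since the geometric mean is at most the
arithmetic one, a state drawn from `v i` leads to the guess `i` with probability at least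
`N ^ (-ε)`. Summed over `i`, these probabilities are at least `N ^ (1 - ε)`; they are at most `m`,
since each state contributes at most the total probability `1` of its guesses
(`rpow_card_le_card_states`).

Exact computation is Las Vegas computation with `ε = 0`, where the bound reads
`obddWidth f ≤ lvOBDDWidth 0 f`; the reverse comparison holds since a deterministic OBDD is a POBDD.
-/

/-! ### Guessing the row from the state -/

open Finset in
/-- Let `v i` be a distribution on states for each row `i`, and let `c s y b` be the probability
of the answer `b` to the test `y` from the state `s`, where the answers make no error and are
neutral with probability at most `ε`. Then each state `s` has a subprobability `q s` on the rows of
`R` such that the geometric mean of `q · i` with weights `v i` is at least `#R ^ (-ε)` for each `i`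
in `R`. The geometric mean, unlike the arithmetic one, is multiplicative along the successive
splits of `R`; a state with `v i s = 0` contributes the factor `1`, also if `q s i = 0`. -/
theorem exists_guess {ι σ Y : Type*} [Fintype σ] {ε : ℝ}
    (v : ι → σ → ℝ) (g : ι → Y → Bool) (c : σ → Y → Bool → ℝ)
    (hv : ∀ i s, 0 ≤ v i s) (hv1 : ∀ i, ∑ s, v i s = 1)
    (hc : ∀ s y b, 0 ≤ c s y b) (hc1 : ∀ s y, c s y true + c s y false ≤ 1)
    (hright : ∀ i y, 1 - ε ≤ ∑ s, v i s * c s y (g i y))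
    (hwrong : ∀ i y, ∑ s, v i s * c s y (!g i y) = 0)
    (R : Finset ι) (hR : R.Nonempty)
    (hsep : ∀ i ∈ R, ∀ k ∈ R, i ≠ k → ∃ y, g i y ≠ g k y) :
    ∃ q : σ → ι → ℝ, (∀ s i, 0 ≤ q s i) ∧ (∀ s, ∑ i ∈ R, q s i ≤ 1) ∧
      ∀ i ∈ R, (#R : ℝ) ^ (-ε) ≤ ∏ s, q s i ^ v i s := by
  classical
  induction R using Finset.strongInduction with
  | H R ih =>
  rcases hR.exists_eq_singleton_or_nontrivial with ⟨a, rfl⟩ | hnt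
  · exact ⟨fun _ _ => 1, by simp, by simp, by simp⟩
  obtain ⟨i₀, hi₀, k₀, hk₀, hne⟩ := hnt
  obtain ⟨y, hy⟩ := hsep i₀ hi₀ k₀ hk₀ hne
  let S : Bool → Finset ι := fun b => R.filter fun i => g i y = b
  have hS : ∀ b, (S b).Nonempty ∧ S b ⊂ R := by
    intro b
    have key : ∃ i ∈ R, g i y = b := by
      by_cases h : g i₀ y = b
      · exact ⟨i₀, hi₀, h⟩
      · exact ⟨k₀, hk₀, by revert h hy; cases g i₀ y <;> cases g k₀ y <;> cases b <;> simp⟩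
    have key' : ∃ i ∈ R, g i y ≠ b := by
      by_cases h : g i₀ y = b
      · exact ⟨k₀, hk₀, fun h' => hy (h.trans h'.symm)⟩
      · exact ⟨i₀, hi₀, h⟩
    obtain ⟨i, hi, hib⟩ := key
    exact ⟨⟨i, mem_filter.2 ⟨hi, hib⟩⟩, filter_ssubset.2 key'⟩
  have hq : ∀ b, ∃ q : σ → ι → ℝ, (∀ s i, 0 ≤ q s i) ∧ (∀ s, ∑ i ∈ S b, q s i ≤ 1) ∧
      ∀ i ∈ S b, (#(S b) : ℝ) ^ (-ε) ≤ ∏ s, q s i ^ v i s := fun b =>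
    ih (S b) (hS b).2 (hS b).1 fun i hi k hk =>
      hsep i ((hS b).2.subset hi) k ((hS b).2.subset hk)
  choose q hq0 hq1 hqv using hq
  have hN : (0 : ℝ) < #R := by exact_mod_cast hR.card_pos
  have hSpos : ∀ b, (0 : ℝ) < #(S b) := fun b => by exact_mod_cast (hS b).1.card_pos
  let p : Bool → ℝ := fun b => #(S b) / #R
  have hp : ∀ b, 0 < p b := fun b => div_pos (hSpos b) hN
  have hp1 : ∀ b, p b ≤ 1 := fun b =>
    (div_le_one hN).2 (by exact_mod_cast card_le_card (hS b).2.subset)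
  have hsplit : ∀ F : ι → ℝ, ∑ i ∈ R, F i = ∑ i ∈ S true, F i + ∑ i ∈ S false, F i := by
    intro F
    rw [← sum_filter_add_sum_filter_not R (fun i => g i y = true)]
    simp [S]
  have hpsum : p true + p false = 1 := by
    have h := hsplit fun _ => 1
    simp only [sum_const, nsmul_eq_mul, mul_one] at h
    simp only [p, ← add_div, ← h, div_self hN.ne']
  -- On a neutral outcome of the test, its value is guessed with the proportions of the two parts.
  let w : σ → Bool → ℝ := fun s b => c s y b + (1 - c s y true - c s y false) * p b
  have hw0 : ∀ s b, 0 ≤ w s b := fun s b =>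
    add_nonneg (hc s y b) (mul_nonneg (by linarith [hc1 s y]) (hp b).le)
  have hw1 : ∀ s, w s true + w s false = 1 := fun s => by
    simp only [w]; linear_combination (1 - c s y true - c s y false) * hpsum
  refine ⟨fun s i => w s (g i y) * q (g i y) s i, fun s i => mul_nonneg (hw0 _ _) (hq0 _ _ _),
    fun s => ?_, fun i hi => ?_⟩
  · have hb : ∀ b, ∑ i ∈ S b, w s (g i y) * q (g i y) s i ≤ w s b := fun b => by
      have : ∑ i ∈ S b, w s (g i y) * q (g i y) s i = w s b * ∑ i ∈ S b, q b s i := by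
        rw [mul_sum]
        exact sum_congr rfl fun i hi => by rw [(mem_filter.1 hi).2]
      rw [this]
      exact mul_le_of_le_one_right (hw0 s b) (hq1 b s)
    rw [hsplit]
    linarith [hb true, hb false, hw1 s]
  · obtain ⟨b, hb⟩ : ∃ b, g i y = b := ⟨_, rfl⟩
    have hwz : ∀ s, v i s * c s y (!b) = 0 := fun s => by
      have h := hwrong i y
      rw [hb, sum_eq_zero_iff_of_nonneg fun s _ => mul_nonneg (hv i s) (hc _ _ _)] at h
      exact h s (mem_univ s)
    -- Weighted AM-GM for `1` and `p b` with the weights `c s y b` and `1 - c s y b`.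
    have hfac : ∀ s, p b ^ (v i s * (1 - c s y b)) ≤ w s b ^ v i s := by
      intro s
      rcases mul_eq_zero.1 (hwz s) with h0 | h0
      · simp [h0]
      · have hcb : c s y b ≤ 1 := by
          have := hc1 s y; have h1 := hc s y true; have h2 := hc s y false
          cases b <;> linarith
        have hwb : w s b = c s y b * 1 + (1 - c s y b) * p b := by
          cases b <;> simp only [Bool.not_true, Bool.not_false] at h0 <;> simp [w, h0]
        have := Real.geom_mean_le_arith_mean2_weighted (hc s y b) (sub_nonneg.2 hcb) zero_le_one
          (hp b).le (by ring)
        rw [Real.one_rpow, one_mul, ← hwb] at this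
        rw [mul_comm, Real.rpow_mul (hp b).le]
        exact Real.rpow_le_rpow (Real.rpow_nonneg (hp b).le _) this (hv i s)
    have hexp : ∑ s, v i s * (1 - c s y b) ≤ ε := by
      have h := hright i y
      rw [hb] at h
      simp only [mul_sub, mul_one, sum_sub_distrib, hv1]
      linarith
    have hprod : p b ^ ε ≤ ∏ s, w s b ^ v i s := calc
      p b ^ ε ≤ p b ^ ∑ s, v i s * (1 - c s y b) :=
        Real.rpow_le_rpow_of_exponent_ge (hp b) (hp1 b) hexp
      _ = ∏ s, p b ^ (v i s * (1 - c s y b)) := Real.rpow_sum_of_pos (hp b) _ _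
      _ ≤ ∏ s, w s b ^ v i s :=
        prod_le_prod (fun s _ => Real.rpow_nonneg (hp b).le _) fun s _ => hfac s
    calc (#R : ℝ) ^ (-ε) = p b ^ ε * (#(S b) : ℝ) ^ (-ε) := by
          simp only [p]
          rw [Real.div_rpow (hSpos b).le hN.le, Real.rpow_neg hN.le, Real.rpow_neg (hSpos b).le]
          have := (Real.rpow_pos_of_pos (hSpos b) ε).ne'
          field_simp
      _ ≤ (∏ s, w s b ^ v i s) * ∏ s, q b s i ^ v i s :=
        mul_le_mul hprod (hqv b i (mem_filter.2 ⟨hi, hb⟩)) (Real.rpow_nonneg (hSpos b).le _)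
          (prod_nonneg fun s _ => Real.rpow_nonneg (hw0 s b) _)
      _ = ∏ s, (w s (g i y) * q (g i y) s i) ^ v i s := by
        simp only [hb]
        rw [← prod_mul_distrib]
        exact prod_congr rfl fun s _ => (Real.mul_rpow (hw0 s b) (hq0 b s i)).symm

/-- A one-way Las Vegas protocol for pairwise distinct rows uses at least `N ^ (1 - ε)` messages,
where `N` is the number of rows. -/
theorem rpow_card_le_card_states {ι σ Y : Type*} [Fintype ι] [Nonempty ι] [Fintype σ] {ε : ℝ}
    (v : ι → σ → ℝ) (g : ι → Y → Bool) (c : σ → Y → Bool → ℝ)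
    (hv : ∀ i s, 0 ≤ v i s) (hv1 : ∀ i, ∑ s, v i s = 1)
    (hc : ∀ s y b, 0 ≤ c s y b) (hc1 : ∀ s y, c s y true + c s y false ≤ 1)
    (hright : ∀ i y, 1 - ε ≤ ∑ s, v i s * c s y (g i y))
    (hwrong : ∀ i y, ∑ s, v i s * c s y (!g i y) = 0) (hg : Function.Injective g) :
    (Fintype.card ι : ℝ) ^ (1 - ε) ≤ Fintype.card σ := by
  obtain ⟨q, hq0, hq1, hq⟩ := exists_guess v g c hv hv1 hc hc1 hright hwrong Finset.univ
    Finset.univ_nonempty fun i _ k _ hik => Function.ne_iff.1 (hg.ne hik)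
  have hN : (0 : ℝ) < Fintype.card ι := by exact_mod_cast Fintype.card_pos
  have hle1 : ∀ i s, v i s ≤ 1 := fun i s => by
    rw [← hv1 i]; exact Finset.single_le_sum (fun s _ => hv i s) (Finset.mem_univ s)
  calc (Fintype.card ι : ℝ) ^ (1 - ε)
      = ∑ _i : ι, (Fintype.card ι : ℝ) ^ (-ε) := by
        rw [Finset.sum_const, Finset.card_univ, nsmul_eq_mul, sub_eq_add_neg, Real.rpow_add hN,
          Real.rpow_one]
    _ ≤ ∑ i, ∑ s, v i s * q s i := Finset.sum_le_sum fun i _ => by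
        refine (hq i (Finset.mem_univ i)).trans ?_
        exact Real.geom_mean_le_arith_mean_weighted _ _ _ (fun s _ => hv i s) (hv1 i)
          fun s _ => hq0 s i
    _ ≤ ∑ i, ∑ s, q s i := Finset.sum_le_sum fun i _ => Finset.sum_le_sum fun s _ =>
        mul_le_of_le_one_left (hq0 s i) (hle1 i s)
    _ = ∑ s, ∑ i, q s i := Finset.sum_comm
    _ ≤ ∑ _s : σ, (1 : ℝ) := Finset.sum_le_sum fun s _ => hq1 s
    _ = Fintype.card σ := by simp

/-! ### Subfunctions and deterministic OBDDs -/

section Subfunction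

variable {n : ℕ}

/-- The input that agrees with `x` on the variables read in the first `j` steps under the order
`π`, and with `z` on the other ones. -/
def splice (π : Equiv.Perm (Fin n)) (j : Fin (n + 1)) (x z : Fin n → Bool) : Fin n → Bool :=
  fun k => if (π.symm k).castSucc < j then x k else z k

/-- The subfunction of `f` left by the variables of `x` read in the first `j` steps. It is encoded
as a function of a full input `z`, which ignores the variables already read. -/
def subfunction (f : (Fin n → Bool) → Bool) (π : Equiv.Perm (Fin n)) (j : Fin (n + 1))
    (x : Fin n → Bool) : (Fin n → Bool) → Bool :=
  fun z => f (splice π j x z)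

theorem splice_last (π : Equiv.Perm (Fin n)) (x z : Fin n → Bool) :
    splice π (Fin.last n) x z = x := by
  funext k; simp [splice, Fin.castSucc_lt_last]

theorem splice_zero (π : Equiv.Perm (Fin n)) (x z : Fin n → Bool) :
    splice π 0 x z = z := by
  funext k; simp [splice]

theorem splice_succ (π : Equiv.Perm (Fin n)) (i : Fin n) (x z : Fin n → Bool) :
    splice π i.succ x z = splice π i.castSucc x (Function.update z (π i) (x (π i))) := by
  funext k
  by_cases hk : k = π i
  · subst hk; simp [splice]
  · have hne : π.symm k ≠ i := fun h => hk (by simp [← h])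
    have : π.symm k < i ↔ π.symm k ≤ i := ⟨le_of_lt, fun h => lt_of_le_of_ne h hne⟩
    simp [splice, Function.update_of_ne hk, this, Fin.castSucc_lt_succ_iff]

theorem splice_castSucc (π : Equiv.Perm (Fin n)) (i : Fin n) (x z : Fin n → Bool) :
    splice π i.castSucc x z = splice π i.succ (Function.update x (π i) (z (π i))) z := by
  funext k
  by_cases hk : k = π i
  · subst hk; simp [splice]
  · have hne : π.symm k ≠ i := fun h => hk (by simp [← h])
    have : π.symm k < i ↔ π.symm k ≤ i := ⟨le_of_lt, fun h => lt_of_le_of_ne h hne⟩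
    simp [splice, Function.update_of_ne hk, this, Fin.castSucc_lt_succ_iff]

/-- The OBDD keeps the current subfunction as its state. This is possible because the subfunction
at level `i + 1` is determined by the one at level `i` and the bit read, by `splice_succ`. -/
theorem obddWidth_le_of_card_subfunction_le (f : (Fin n → Bool) → Bool) (π : Equiv.Perm (Fin n))
    {M : ℕ} (hM : ∀ j, (Finset.univ.image (subfunction f π j)).card ≤ M) : obddWidth f ≤ M := by
  classical
  have henc : ∀ j, ∃ (e : ((Fin n → Bool) → Bool) → Fin M) (d : Fin M → (Fin n → Bool) → Bool),
      ∀ x, d (e (subfunction f π j x)) = subfunction f π j x := by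
    intro j
    let A := Finset.univ.image (subfunction f π j)
    have hmem : ∀ x, subfunction f π j x ∈ A := fun x =>
      Finset.mem_image_of_mem _ (Finset.mem_univ x)
    have hpos : 0 < M := (Finset.card_pos.2 ⟨_, hmem fun _ => false⟩).trans_le (hM j)
    let e : ((Fin n → Bool) → Bool) → Fin M := fun r =>
      if h : r ∈ A then Fin.castLE (hM j) (A.equivFin ⟨r, h⟩) else ⟨0, hpos⟩
    have he : Set.InjOn e A := by
      intro r hr r' hr' h
      simp only [e, dif_pos (Finset.mem_coe.1 hr), dif_pos (Finset.mem_coe.1 hr')] at h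
      simpa using h
    exact ⟨e, Function.invFunOn e A, fun x => he.leftInvOn_invFunOn (hmem x)⟩
  -- `e j` encodes subfunctions of level `j` as states, and `d j` decodes them.
  choose e d hed using henc
  let P : DetOBDD n M :=
    { order := π
      init := e 0 f
      step := fun i b s => e i.succ fun z => d i.castSucc s (Function.update z (π i) b)
      accept := Finset.univ.filter fun s => d (Fin.last n) s (fun _ => false) = true }
  have hstate : ∀ x j, P.stateAt x j = e j (subfunction f π j x) := by
    intro x j
    induction j using Fin.induction with
    | zero =>
      have : subfunction f π 0 x = f := funext fun z => by rw [subfunction, splice_zero]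
      rw [this]; simp [DetOBDD.stateAt, P]
    | succ i ih =>
      have h : P.stateAt x i.succ = P.step i (x (P.order i)) (P.stateAt x i.castSucc) := by
        simp [DetOBDD.stateAt]
      rw [h, ih]
      simp only [P, hed]
      congr 1
      funext z
      rw [subfunction, subfunction, splice_succ]
  refine Nat.sInf_le ⟨P, fun x => ?_⟩
  rw [hstate]
  simp [P, hed, subfunction, splice_last]

end Subfunction

/-! ### Las Vegas POBDDs at a fixed level -/

namespace POBDD

variable {n m : ℕ}

theorem vecAt_succ (P : POBDD n m) (x : Fin n → Bool) (i : Fin n) :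
    P.vecAt x i.succ = (P.trans i (x (P.order i))).mulVec (P.vecAt x i.castSucc) := by
  simp [vecAt]

theorem vecAt_congr (P : POBDD n m) {x x' : Fin n → Bool} (j : Fin (n + 1))
    (h : ∀ i : Fin n, i.castSucc < j → x (P.order i) = x' (P.order i)) :
    P.vecAt x j = P.vecAt x' j := by
  induction j using Fin.induction with
  | zero => simp [vecAt]
  | succ i ih =>
    rw [vecAt_succ, vecAt_succ, h i (Fin.castSucc_lt_succ),
      ih fun k hk => h k (hk.trans Fin.castSucc_lt_succ)]

theorem vecAt_mem_stdSimplex (P : POBDD n m) (x : Fin n → Bool) (j : Fin (n + 1)) :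
    P.vecAt x j ∈ stdSimplex ℝ (Fin m) := by
  induction j using Fin.induction with
  | zero => simpa [vecAt] using P.init_mem
  | succ i ih =>
    rw [vecAt_succ]
    obtain ⟨h0, h1⟩ := Matrix.mem_colStochastic_iff_sum.1 (P.trans_mem i (x (P.order i)))
    simp only [stdSimplex, Set.mem_ofPred_eq, Matrix.mulVec, dotProduct]
    refine ⟨fun s => Finset.sum_nonneg fun t _ => mul_nonneg (h0 s t) (ih.1 t), ?_⟩
    rw [Finset.sum_comm]
    simp only [← Finset.sum_mul, h1, one_mul, ih.2]

/-- The steps after level `j` act on the vector at level `j` by one column-stochastic matrix, which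
depends on the values `z` of the later variables only. -/
theorem exists_suffix_matrix (P : POBDD n m) (z : Fin n → Bool) (j : Fin (n + 1)) :
    ∃ K ∈ Matrix.colStochastic ℝ (Fin m), ∀ x,
      P.vecAt (splice P.order j x z) (Fin.last n) = K.mulVec (P.vecAt x j) := by
  induction j using Fin.reverseInduction with
  | last => exact ⟨1, one_mem _, fun x => by rw [splice_last, Matrix.one_mulVec]⟩
  | cast i ih =>
    obtain ⟨K, hK, h⟩ := ih
    refine ⟨K * P.trans i (z (P.order i)), mul_mem hK (P.trans_mem _ _), fun x => ?_⟩
    rw [splice_castSucc, h, vecAt_succ, Function.update_self, Matrix.mulVec_mulVec,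
      P.vecAt_congr (x' := x)]
    intro k hk
    exact Function.update_of_ne (fun h' => (Fin.castSucc_lt_castSucc_iff.1 hk).ne
      (P.order.injective h')) _ _

end POBDD

theorem LVPOBDD.rpow_card_subfunction_le {n m : ℕ} {ε : ℝ} {f : (Fin n → Bool) → Bool}
    (P : LVPOBDD n m) (hP : P.Computes ε f) (j : Fin (n + 1)) :
    ((Finset.univ.image (subfunction f P.order j)).card : ℝ) ^ (1 - ε) ≤ m := by
  classical
  let A := Finset.univ.image (subfunction f P.order j)
  have hA : ∀ r : A, ∃ x, subfunction f P.order j x = r := fun r => by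
    obtain ⟨x, -, hx⟩ := Finset.mem_image.1 r.2
    exact ⟨x, hx⟩
  choose x hx using hA
  choose K hK hKx using fun z => P.exists_suffix_matrix z j
  -- The rows are the subfunctions, the tests are the values `z` of the later variables, and
  -- `c s z b` is the probability that the run from `s` on `z` answers `b`.
  let out : Bool → Finset (Fin m) := fun b => bif b then P.accept else P.reject
  let c : Fin m → (Fin n → Bool) → Bool → ℝ := fun s z b => ∑ t ∈ out b, K z t s
  have hcol := fun z => Matrix.mem_colStochastic_iff_sum.1 (hK z)
  have hprob : ∀ (r : A) z b,
      ∑ s, P.vecAt (x r) j s * c s z b = P.prob (splice P.order j (x r) z) (out b) := by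
    intro r z b
    simp only [c, POBDD.prob, hKx, Matrix.mulVec, dotProduct, Finset.mul_sum]
    rw [Finset.sum_comm]
    simp only [mul_comm]
  have hval : ∀ (r : A) z, f (splice P.order j (x r) z) = r.1 z := fun r z =>
    congrFun (hx r) z
  have : Nonempty A := ⟨⟨_, Finset.mem_image_of_mem _ (Finset.mem_univ fun _ => false)⟩⟩
  have := rpow_card_le_card_states (ε := ε) (fun r : A => P.vecAt (x r) j) (fun r => r.1) c
    (fun r s => (P.vecAt_mem_stdSimplex (x r) j).1 s)
    (fun r => (P.vecAt_mem_stdSimplex (x r) j).2)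
    (fun s z b => Finset.sum_nonneg fun t _ => (hcol z).1 t s)
    (fun s z => by
      rw [← (hcol z).2 s]
      simp only [c, out, cond_true, cond_false]
      rw [← Finset.sum_union P.disjoint_accept_reject]
      exact Finset.sum_le_sum_of_subset_of_nonneg (Finset.subset_univ _)
        fun t _ _ => (hcol z).1 t s)
    (fun r z => by
      rw [hprob]
      have h := hP (splice P.order j (x r) z)
      rw [hval] at h
      cases hb : r.1 z
      · exact (h.2 hb).2
      · exact (h.1 hb).2)
    (fun r z => by
      rw [hprob]
      have h := hP (splice P.order j (x r) z)
      rw [hval] at h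
      cases hb : r.1 z
      · exact (h.2 hb).1
      · exact (h.1 hb).1)
    Subtype.val_injective
  rwa [Fintype.card_coe, Fintype.card_fin] at this

/-! ### Comparison of the minimum widths -/

/-- The bound at the level with the most subfunctions, for the variable order of an optimal Las
Vegas POBDD. -/
theorem rpow_obddWidth_le_lvOBDDWidth {n : ℕ} (f : (Fin n → Bool) → Bool) {ε : ℝ} (hε : 0 ≤ ε)
    (hε1 : ε < 1) : (obddWidth f : ℝ) ^ (1 - ε) ≤ lvOBDDWidth ε f := by
  obtain ⟨P, hP⟩ := Nat.sInf_mem (exists_lvOBDD hε f)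
  obtain ⟨j, -, hj⟩ := Finset.exists_max_image Finset.univ
    (fun j => (Finset.univ.image (subfunction f P.order j)).card) Finset.univ_nonempty
  have h := obddWidth_le_of_card_subfunction_le f P.order fun k => hj k (Finset.mem_univ k)
  exact (Real.rpow_le_rpow (Nat.cast_nonneg _) (Nat.cast_le.2 h) (by linarith)).trans
    (P.rpow_card_subfunction_le hP j)

theorem POBDD.prob_compl {n m : ℕ} (P : POBDD n m) (x : Fin n → Bool) (A : Finset (Fin m)) :
    P.prob x Aᶜ = 1 - P.prob x A := by
  rw [eq_sub_iff_add_eq, prob, prob, Finset.sum_compl_add_sum]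
  exact (P.vecAt_mem_stdSimplex x _).2

theorem lvOBDDWidth_zero_le_exactPOBDDWidth {n : ℕ} (f : (Fin n → Bool) → Bool) :
    lvOBDDWidth 0 f ≤ exactPOBDDWidth f := by
  obtain ⟨P, hP⟩ := Nat.sInf_mem (exists_exactPOBDD f)
  let Q : LVPOBDD n (exactPOBDDWidth f) :=
    { P with
      reject := P.acceptᶜ
      disjoint_accept_reject := disjoint_compl_right }
  refine Nat.sInf_le ⟨Q, fun x => ?_⟩
  have ha : Q.prob x Q.accept = if f x = true then 1 else 0 := hP x
  have hr : Q.prob x Q.reject = 1 - Q.prob x Q.accept := P.prob_compl x P.accept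
  rw [hr, ha]
  constructor <;> intro hf <;> simp [hf]

theorem exactPOBDDWidth_le_obddWidth {n : ℕ} (f : (Fin n → Bool) → Bool) :
    exactPOBDDWidth f ≤ obddWidth f := by
  refine le_csInf (exists_detOBDD f) fun m ⟨P, hP⟩ => Nat.sInf_le ⟨P.toPOBDD, fun x => ?_⟩
  have h : P.stateAt x (Fin.last n) ∈ P.toPOBDD.accept ↔ f x = true := hP x
  simp only [DetOBDD.prob_toPOBDD, h]

theorem mainTheorem1 (n : ℕ) (f : (Fin n → Bool) → Bool) :
    (∀ ε : ℝ, 0 ≤ ε → ε < 1 → (obddWidth f : ℝ) ^ (1 - ε) ≤ (lvOBDDWidth ε f : ℝ)) ∧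
      obddWidth f = exactPOBDDWidth f := by
  refine ⟨fun ε hε hε1 => rpow_obddWidth_le_lvOBDDWidth f hε hε1, le_antisymm ?_
    (exactPOBDDWidth_le_obddWidth f)⟩
  have h := rpow_obddWidth_le_lvOBDDWidth f le_rfl zero_lt_one
  rw [sub_zero, Real.rpow_one, Nat.cast_le] at h
  exact h.trans (lvOBDDWidth_zero_le_exactPOBDDWidth f)
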